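/- Let $(\Omega,\Sigma,\mathbb P)$ be a probability space, let $W=(W(t))_{t\ge 0}$ be a one-dimensional Wiener process on it (with $W(0)=0$ a.s. and almost surely continuous paths), and let $T\in(0,\infty)$. Put $\mathcal I(W)=\int_0^T W(t)\,dt$. A method $\bar X=(\bar X_n)_{n\ge 1}$ is given by partitions $0=t_{0,n}<t_{1,n}<\dots<t_{n,n}=T$ and Borel functions $\varphi_n:\mathbb R^n\to\mathbb R$, $n\ge 1$, through $$\bar X_n=\varphi_n\bigl(W(t_{1,n}),\dots,W(t_{n,n})\bigr),$$ and its $n$th error is $e_n(\bar X)=\|\mathcal I(W)-\bar X_n\|_{L^2(\Omega)}\in[0,\infty]$. Let $\chi^{\rm noneq}$ be the class of all methods with $\mathbb E|\bar X_n|^2<\infty$ for all $n\ge 1$, and let $\chi^{\rm eq}\subset\chi^{\rm noneq}$ be the subclass of methods with $t_{i,n}=iT/n$ for all $n\geq 1$ and $0\le i\le n$. Then the following holds. (i) For every method $\bar X$ and every $n\ge 1$, $$e_n(\bar X)\ \ge\ \frac{T^{3/2}}{\sqrt{12}}\,n^{-1}.$$ (ii) The equidistant trapezoidal rule, with $t_i=iT/n$,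 $$\bar X^{\rm eq}_n=\frac{T}{2n}\sum_{i=0}^{n-1}\bigl(W(t_i)+W(t_{i+1})\bigr)=\frac Tn\sum_{i=0}^{n-1}W(t_i)+\frac{T}{2n}W(t_n)\quad\text{a.s.},\qquad n\ge 1,$$ coincides almost surely, for all $n\geq 1$, with a method from $\chi^{\rm eq}$, and for every $n\ge 1$ $$e_n(\bar X^{\rm eq})=\frac{T^{3/2}}{\sqrt{12}}\,n^{-1}.$$ (iii) Consequently $\bar X^{\rm eq}$ is optimal in $\chi^{\rm noneq}$: for every $n\ge 1$ $$e_n(\bar X^{\rm eq})=\inf_{\bar X\in\chi^{\rm noneq}}e_n(\bar X)=\frac{T^{3/2}}{\sqrt{12}}\,n^{-1}.$$ -/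

import Mathlib

open MeasureTheory ProbabilityTheory
open scoped NNReal ENNReal

namespace WienerIntegration

/-- The integral `∫_0^T W(t) dt`, path by path. -/
noncomputable def pathIntegral {Ω : Type*} (T : ℝ≥0) (W : ℝ≥0 → Ω → ℝ) (ω : Ω) : ℝ :=
  ∫ t in (0 : ℝ)..(T : ℝ), W t.toNNReal ω

/-- A deterministic-information method on `[0, T]`: for every `n ≥ 1` a partition
`0 = t_{0,n} < t_{1,n} < … < t_{n,n} = T` and a Borel function `φ_n : ℝⁿ → ℝ`. -/
structure SamplingMethod (T : ℝ≥0) where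
  knots : (n : ℕ+) → Fin ((n : ℕ) + 1) → ℝ≥0
  knots_strictMono : ∀ n, StrictMono (knots n)
  knots_first : ∀ n, knots n 0 = 0
  knots_last : ∀ n, knots n (Fin.last (n : ℕ)) = T
  φ : (n : ℕ+) → (Fin (n : ℕ) → ℝ) → ℝ
  measurable_φ : ∀ n, Measurable (φ n)

namespace SamplingMethod

variable {Ω : Type*} {T : ℝ≥0}

/-- The information `(W(t_{1,n}), …, W(t_{n,n}))` that the method uses. -/
def info (X : SamplingMethod T) (W : ℝ≥0 → Ω → ℝ) (n : ℕ+) (ω : Ω) : Fin (n : ℕ) → ℝ :=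
  fun i => W (X.knots n i.succ) ω

/-- The `n`-th approximation `φ_n (W(t_{1,n}), …, W(t_{n,n}))`. -/
def approx (X : SamplingMethod T) (W : ℝ≥0 → Ω → ℝ) (n : ℕ+) (ω : Ω) : ℝ :=
  X.φ n (X.info W n ω)

end SamplingMethod

/-- All methods (with arbitrary, possibly non-uniform partitions) whose approximations all have
a finite second moment. -/
def noneqClass {Ω : Type*} [MeasurableSpace Ω] (P : Measure Ω) (T : ℝ≥0) (W : ℝ≥0 → Ω → ℝ) :
    Set (SamplingMethod T) :=
  {X | ∀ n : ℕ+, MemLp (X.approx W n) 2 P}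

/-- The methods in `noneqClass` that use the equidistant partitions `t_{i,n} = i T / n`. -/
def eqClass {Ω : Type*} [MeasurableSpace Ω] (P : Measure Ω) (T : ℝ≥0) (W : ℝ≥0 → Ω → ℝ) :
    Set (SamplingMethod T) :=
  {X | X ∈ noneqClass P T W ∧
    ∀ (n : ℕ+) (i : Fin ((n : ℕ) + 1)), X.knots n i = (i : ℕ) * T / (n : ℕ)}

/-- The error `‖∫_0^T W(t) dt - Y‖_{L²(Ω)}` of an approximation `Y`; it is `∞` when the difference
is not square integrable. -/
noncomputable def l2Error {Ω : Type*} [MeasurableSpace Ω] (P : Measure Ω) (T : ℝ≥0)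
    (W : ℝ≥0 → Ω → ℝ) (Y : Ω → ℝ) : ℝ≥0∞ :=
  eLpNorm (fun ω => pathIntegral T W ω - Y ω) 2 P

/-- The equidistant trapezoidal rule
`T / (2 n) * ∑_{i=0}^{n-1} (W(t_i) + W(t_{i+1}))` with `t_i = i T / n`. -/
noncomputable def trapezoidalRule {Ω : Type*} (T : ℝ≥0) (W : ℝ≥0 → Ω → ℝ) (n : ℕ+) (ω : Ω) : ℝ :=
  (T : ℝ) / (2 * (n : ℕ)) *
    ∑ i ∈ Finset.range (n : ℕ),
      (W ((i : ℝ≥0) * T / (n : ℕ)) ω + W (((i : ℝ≥0) + 1) * T / (n : ℕ)) ω)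

end WienerIntegration

/-! Given the values of `W` at the nodes, the conditional mean of the path is its piecewise linear
interpolation. So the trapezoidal sum `Q` over the nodes is the `L²` projection of the path integral
`I` onto functions of those values. This is proved as orthogonality of `I - Q` to every such square
integrable function (`integral_pathIntegral_mul_eq`), by Fubini and the independence of the Brownian
bridge from the node values (`integral_eval_mul_of_mem_Icc`). By Pythagoras, no method beats `Q` on
its own nodes (`l2Error_trapezoidalSum_le`).

With step lengths `h_i`, the squared error of `Q` is `∑ h_i ^ 3 / 12`
(`integral_sq_pathIntegral_sub_trapezoidalSum`). Convexity bounds this below by `T ^ 3 / (12 n ^ 2)`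
(`cube_div_sq_le_sum`), and equal steps attain the bound. -/

/-! ### Joint measurability of Brownian motion -/

open Filter Topology in
/-- A Brownian motion is jointly measurable in `(ω, t)`, up to a null set. -/
theorem ProbabilityTheory.IsBrownianReal.aemeasurable_uncurry {Ω : Type*} [MeasurableSpace Ω]
    {P : Measure Ω} [IsProbabilityMeasure P] {W : ℝ≥0 → Ω → ℝ} (hW : IsBrownianReal W P)
    (μ : Measure ℝ) [SFinite μ] :
    AEMeasurable (fun p : Ω × ℝ => W p.2.toNNReal p.1) (P.prod μ) := by
  choose W' hW'm hW' using hW.toIsPreBrownianReal.aemeasurable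
  -- Time is rounded down to the grid `ℕ / m`: only countably many times occur, so the null sets can
  -- be united, and path continuity gives the limit.
  let V : ℕ → Ω × ℝ → ℝ := fun m p =>
    W' (((⌊(p.2.toNNReal : ℝ) * m⌋₊ : ℝ) / m).toNNReal) p.1
  have hV : ∀ m, Measurable (V m) := by
    intro m
    have h1 : Measurable (fun q : Ω × ℕ => W' (((q.2 : ℝ) / m).toNNReal) q.1) :=
      measurable_from_prod_countable_left fun k => hW'm ((k : ℝ) / m).toNNReal
    have h2 : Measurable (fun p : Ω × ℝ => (p.1, ⌊(p.2.toNNReal : ℝ) * m⌋₊)) := by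
      fun_prop
    exact h1.comp h2
  refine aemeasurable_of_tendsto_metrizable_ae atTop (f := V) (fun m => (hV m).aemeasurable) ?_
  have hgood : ∀ᵐ ω ∂P, Continuous (W · ω) ∧ ∀ m k : ℕ,
      W (((k : ℝ) / m).toNNReal) ω = W' (((k : ℝ) / m).toNNReal) ω :=
    hW.cont.and (ae_all_iff.2 fun m => ae_all_iff.2 fun k => hW' _)
  filter_upwards [Measure.quasiMeasurePreserving_fst.ae hgood] with p hp
  have h1 : Tendsto (fun m : ℕ => ((⌊(p.2.toNNReal : ℝ) * m⌋₊ : ℝ) / m).toNNReal) atTop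
      (𝓝 p.2.toNNReal) := by
    have := (tendsto_nat_floor_mul_div_atTop (R := ℝ) (a := (p.2.toNNReal : ℝ))
      (NNReal.coe_nonneg _)).comp tendsto_natCast_atTop_atTop
    have h := (continuous_real_toNNReal.tendsto _).comp this
    rwa [Real.toNNReal_coe] at h
  refine ((hp.1.tendsto _).comp h1).congr fun m => ?_
  exact hp.2 m _

/-! ### Second moments and Fubini for the path integral -/

namespace WienerIntegration

theorem pathIntegral_eq_setIntegral {Ω : Type*} (T : ℝ≥0) (W : ℝ≥0 → Ω → ℝ) (ω : Ω) :
    pathIntegral T W ω = ∫ t in Set.Ioc (0 : ℝ) T, W t.toNNReal ω :=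
  intervalIntegral.integral_of_le T.coe_nonneg

variable {Ω : Type*} [MeasurableSpace Ω] {P : Measure Ω} {W : ℝ≥0 → Ω → ℝ}

theorem memLp_eval (hW : IsBrownianReal W P) (t : ℝ≥0) : MemLp (W t) 2 P :=
  (hW.toIsPreBrownianReal.isGaussianProcess.hasGaussianLaw_eval t).memLp_two

variable [IsProbabilityMeasure P]

theorem integral_eval_mul_eval (hW : IsBrownianReal W P) (s t : ℝ≥0) :
    ∫ ω, W s ω * W t ω ∂P = min s t := by
  have h := covariance_eq_sub (memLp_eval hW s) (memLp_eval hW t)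
  rw [hW.toIsPreBrownianReal.covariance_eval, hW.toIsPreBrownianReal.integral_eval] at h
  simpa using h.symm

theorem memLp_uncurry (hW : IsBrownianReal W P) (T : ℝ≥0) :
    MemLp (fun p : Ω × ℝ => W p.2.toNNReal p.1) 2
      (P.prod (volume.restrict (Set.Ioc (0 : ℝ) T))) := by
  have hmeas := (hW.aemeasurable_uncurry
    (volume.restrict (Set.Ioc (0 : ℝ) T))).aestronglyMeasurable
  rw [memLp_two_iff_integrable_sq hmeas]
  refine (integrable_prod_iff' (hmeas.pow 2)).2
    ⟨ae_of_all _ fun s => (memLp_eval hW s.toNNReal).integrable_sq, ?_⟩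
  have : (fun s : ℝ => ∫ ω, ‖(W s.toNNReal ω) ^ 2‖ ∂P) = fun s => (s.toNNReal : ℝ) := by
    ext s
    simpa [sq] using integral_eval_mul_eval hW s.toNNReal s.toNNReal
  refine Integrable.congr (f := fun s : ℝ => (s.toNNReal : ℝ)) ?_
    (ae_of_all _ fun s => (congrFun this s).symm)
  exact (Continuous.integrableOn_Icc (by fun_prop)).mono_set Set.Ioc_subset_Icc_self

theorem memLp_pathIntegral (hW : IsBrownianReal W P) (T : ℝ≥0) :
    MemLp (pathIntegral T W) 2 P := by
  have h := memLp_uncurry hW T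
  have hmeas : AEStronglyMeasurable (pathIntegral T W) P := by
    simp_rw [funext (pathIntegral_eq_setIntegral T W)]
    exact h.1.integral_prod_right'
  rw [memLp_two_iff_integrable_sq hmeas]
  refine (h.integrable_sq.integral_prod_left.const_mul (T : ℝ)).mono' (hmeas.pow 2) ?_
  filter_upwards [hW.cont] with ω hω
  rw [Real.norm_of_nonneg (sq_nonneg _)]
  rcases eq_or_ne T 0 with rfl | hT
  · simp [pathIntegral]
  have hT' : (0 : ℝ) < T := by positivity
  have hc : Continuous fun t : ℝ => W t.toNNReal ω := hω.comp continuous_real_toNNReal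
  -- Cauchy–Schwarz in the form `I ^ 2 ≤ T * ∫ W ^ 2`: the path has nonnegative variance about its
  -- time average.
  have h0 : 0 ≤ ∫ t in (0 : ℝ)..T, (W t.toNNReal ω - pathIntegral T W ω / T) ^ 2 :=
    intervalIntegral.integral_nonneg hT'.le fun t _ => sq_nonneg _
  have h1 : ∫ t in (0 : ℝ)..T, (W t.toNNReal ω - pathIntegral T W ω / T) ^ 2
      = (∫ t in (0 : ℝ)..T, W t.toNNReal ω ^ 2) - pathIntegral T W ω ^ 2 / T := by
    have (t : ℝ) : (W t.toNNReal ω - pathIntegral T W ω / T) ^ 2 =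
        W t.toNNReal ω ^ 2 - 2 * (pathIntegral T W ω / T) * W t.toNNReal ω
          + (pathIntegral T W ω / T) ^ 2 := by ring
    simp_rw [this]
    rw [intervalIntegral.integral_add
      (Continuous.intervalIntegrable (by fun_prop) _ _)
      (Continuous.intervalIntegrable (by fun_prop) _ _), intervalIntegral.integral_sub
      (Continuous.intervalIntegrable (by fun_prop) _ _)
      (Continuous.intervalIntegrable (by fun_prop) _ _),
      intervalIntegral.integral_const_mul, intervalIntegral.integral_const]
    change _ - _ * pathIntegral T W ω + _ = _
    simp only [sub_zero, smul_eq_mul]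
    field_simp
    ring
  rw [h1, intervalIntegral.integral_of_le hT'.le] at h0
  have := mul_nonneg hT'.le h0
  rw [mul_sub, mul_div_cancel₀ _ hT'.ne'] at this
  linarith

/-- Fubini's theorem for the path integral tested against a square integrable variable. -/
theorem integral_pathIntegral_mul (hW : IsBrownianReal W P) (T : ℝ≥0) {U : Ω → ℝ}
    (hU : MemLp U 2 P) :
    ∫ ω, pathIntegral T W ω * U ω ∂P = ∫ s in (0 : ℝ)..T, ∫ ω, W s.toNNReal ω * U ω ∂P := by
  have h := (memLp_uncurry hW T).integrable_mul
    (hU.comp_fst (volume.restrict (Set.Ioc (0 : ℝ) T)))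
  rw [intervalIntegral.integral_of_le T.coe_nonneg, integral_integral_swap]
  · simp_rw [pathIntegral_eq_setIntegral, integral_mul_const]
  · exact h.swap

end WienerIntegration

/-! ### Orthogonality and error of the trapezoidal sum on arbitrary nodes -/

namespace WienerIntegration

variable {Ω : Type*} [MeasurableSpace Ω] {P : Measure Ω} [IsProbabilityMeasure P]
  {W : ℝ≥0 → Ω → ℝ}

/-- Given the values of `W` at times outside `(a, b)`, the conditional mean of `W s` with
`s ∈ [a, b]` is the linear interpolation of `W a` and `W b`. -/
theorem integral_eval_mul_of_mem_Icc (hW : IsBrownianReal W P) {κ : Type*} [Finite κ]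
    {t : κ → ℝ≥0} {a s b : ℝ≥0} (has : a ≤ s) (hsb : s ≤ b) (hab : a < b)
    (ht : ∀ j, t j ≤ a ∨ b ≤ t j) {g : (κ → ℝ) → ℝ} (hg : Measurable g)
    (hZ : MemLp (fun ω => g fun j => W (t j) ω) 2 P) :
    ∫ ω, W s ω * g (fun j => W (t j) ω) ∂P =
      (((b : ℝ) - s) * (∫ ω, W a ω * g (fun j => W (t j) ω) ∂P)
        + ((s : ℝ) - a) * ∫ ω, W b ω * g (fun j => W (t j) ω) ∂P) / (b - a) := by
  classical
  have := Fintype.ofFinite κ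
  have hB := hW.toIsPreBrownianReal
  have hm := memLp_eval hW
  set Z : Ω → ℝ := fun ω => g fun j => W (t j) ω
  -- The deviation of `W s` from the linear interpolation of `W a` and `W b`, multiplied by `b - a`.
  let R : Ω → ℝ := fun ω =>
    (((b : ℝ) - a) * W s ω - ((b : ℝ) - s) * W a ω) - ((s : ℝ) - a) * W b ω
  have hR : MemLp R 2 P := (((hm s).const_mul _).sub ((hm a).const_mul _)).sub ((hm b).const_mul _)
  have hGauss : HasGaussianLaw (fun ω => (fun _ : Unit => R ω, fun j => W (t j) ω)) P := by
    let S : Finset ℝ≥0 := {s, a, b} ∪ Finset.univ.image t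
    let L : (S → ℝ) →L[ℝ] (Unit → ℝ) × (κ → ℝ) :=
      { toFun x := (fun _ => (((b : ℝ) - a) * x ⟨s, by simp [S]⟩ - ((b : ℝ) - s) * x ⟨a, by simp [S]⟩)
            - ((s : ℝ) - a) * x ⟨b, by simp [S]⟩, fun j => x ⟨t j, by simp [S]⟩)
        map_add' x y := by ext <;> simp; ring
        map_smul' c x := by ext <;> simp; ring }
    exact (hB.isGaussianProcess.hasGaussianLaw S).map L
  have hind : IndepFun (fun ω (_ : Unit) => R ω) (fun ω j => W (t j) ω) P := by
    refine hGauss.indepFun_of_covariance_eval (X := fun _ => R) (Y := fun j => W (t j))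
      fun _ j => ?_
    simp only [R]
    have hsa : MemLp (fun ω => ((b : ℝ) - a) * W s ω - ((b : ℝ) - s) * W a ω) 2 P :=
      ((hm s).const_mul _).sub ((hm a).const_mul _)
    rw [covariance_fun_sub_left hsa ((hm b).const_mul _) (hm _), covariance_fun_sub_left ((hm s).const_mul _)
      ((hm a).const_mul _) (hm _), covariance_const_mul_left, covariance_const_mul_left,
      covariance_const_mul_left, hB.covariance_eval, hB.covariance_eval, hB.covariance_eval]
    -- No `t j` lies inside `(a, b)`, so `min s (t j)` is affine in `s` on `[a, b]` and the
    -- covariance with `R` vanishes.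
    rcases ht j with h | h
    · rw [min_eq_right h, min_eq_right (h.trans has), min_eq_right (h.trans hab.le)]
      ring
    · rw [min_eq_left h, min_eq_left (hsb.trans h), min_eq_left (hab.le.trans h)]
      ring
  have hRZ : ∫ ω, R ω * Z ω ∂P = 0 := by
    have he : Measurable fun x : Unit → ℝ => x () := by fun_prop
    have h := hind.comp he hg
    have h2 := h.integral_fun_mul_eq_mul_integral hR.1 hZ.1
    have hR0 : ∫ ω, R ω ∂P = 0 := by
      have hi := hB.integrable_eval
      simp only [R]
      have hsa : Integrable (fun ω => ((b : ℝ) - a) * W s ω - ((b : ℝ) - s) * W a ω) P :=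
        ((hi s).const_mul _).sub ((hi a).const_mul _)
      rw [integral_sub hsa ((hi b).const_mul _),
        integral_sub ((hi s).const_mul _) ((hi a).const_mul _)]
      simp [integral_const_mul, hB.integral_eval]
    have h3 : ∫ ω, R ω * Z ω ∂P = (∫ ω, R ω ∂P) * ∫ ω, Z ω ∂P := h2
    rw [h3, hR0, zero_mul]
  have hi : ∀ r, Integrable (fun ω => W r ω * Z ω) P := fun r => (hm r).integrable_mul hZ
  have hexp : ∫ ω, R ω * Z ω ∂P = ((b : ℝ) - a) * (∫ ω, W s ω * Z ω ∂P)
      - ((b : ℝ) - s) * (∫ ω, W a ω * Z ω ∂P) - ((s : ℝ) - a) * ∫ ω, W b ω * Z ω ∂P := by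
    have hsa : Integrable (fun ω =>
        ((b : ℝ) - a) * (W s ω * Z ω) - ((b : ℝ) - s) * (W a ω * Z ω)) P :=
      ((hi s).const_mul _).sub ((hi a).const_mul _)
    rw [← integral_const_mul, ← integral_const_mul, ← integral_const_mul,
      ← integral_sub ((hi s).const_mul _) ((hi a).const_mul _),
      ← integral_sub hsa ((hi b).const_mul _)]
    congr 1 with ω
    simp only [R]
    ring
  have hne : (b : ℝ) - a ≠ 0 := sub_ne_zero.2 (by exact_mod_cast hab.ne')
  rw [eq_div_iff hne]
  linarith

/-- The integral over an interval split along a finite sequence of nodes. -/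
theorem integral_eq_sum_fin {n : ℕ} {f : ℝ → ℝ} (t : Fin (n + 1) → ℝ)
    (hf : ∀ i : Fin n, IntervalIntegrable f volume (t i.castSucc) (t i.succ)) :
    IntervalIntegrable f volume (t 0) (t (Fin.last n)) ∧
      ∫ s in t 0..t (Fin.last n), f s = ∑ i : Fin n, ∫ s in t i.castSucc..t i.succ, f s := by
  induction n with
  | zero => simp
  | succ n ih =>
    obtain ⟨h1, h2⟩ := ih (fun i => t i.castSucc) fun i => hf i.castSucc
    have h3 := hf (Fin.last n)
    simp only [Fin.castSucc_zero] at h1 h2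
    refine ⟨h1.trans h3, ?_⟩
    rw [Fin.sum_univ_castSucc, ← Fin.succ_last,
      ← intervalIntegral.integral_add_adjacent_intervals h1 h3, h2]
    rfl

/-- The trapezoidal rule is exact for affine functions. Integrability is part of the conclusion
because `f` will be an expectation whose regularity is known only through its affine form. -/
theorem integral_of_affine {f : ℝ → ℝ} {a b : ℝ} (hab : a < b)
    (hf : ∀ s ∈ Set.Icc a b, f s = ((b - s) * f a + (s - a) * f b) / (b - a)) :
    IntervalIntegrable f volume a b ∧ ∫ s in a..b, f s = (b - a) / 2 * (f a + f b) := by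
  have hf' : Set.EqOn f (fun s => ((b - s) * f a + (s - a) * f b) / (b - a)) (Set.uIcc a b) := by
    rwa [Set.uIcc_of_le hab.le]
  have hc : Continuous fun s : ℝ => ((b - s) * f a + (s - a) * f b) / (b - a) := by fun_prop
  constructor
  · exact (intervalIntegrable_congr (hf'.mono Set.uIoc_subset_uIcc)).2 (hc.intervalIntegrable _ _)
  · rw [intervalIntegral.integral_congr hf']
    have hne : b - a ≠ 0 := (sub_pos.2 hab).ne'
    have hd : ∀ s : ℝ, HasDerivAt (fun s => (-((b - s) ^ 2) * f a + (s - a) ^ 2 * f b) / (2 * (b - a)))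
        (((b - s) * f a + (s - a) * f b) / (b - a)) s := by
      intro s
      have h1 := (((((hasDerivAt_id s).const_sub b).pow 2).neg.mul_const (f a)).add
        ((((hasDerivAt_id s).sub_const a).pow 2).mul_const (f b))).div_const (2 * (b - a))
      refine h1.congr_deriv ?_
      simp only [id]
      field_simp
      ring
    rw [intervalIntegral.integral_eq_sub_of_hasDerivAt (fun s _ => hd s) (hc.intervalIntegrable _ _)]
    field_simp
    ring

/-- The trapezoidal sum of the path of `W` with the nodes `t`. -/
noncomputable def trapezoidalSum {Ω : Type*} {n : ℕ} (t : Fin (n + 1) → ℝ≥0) (W : ℝ≥0 → Ω → ℝ)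
    (ω : Ω) : ℝ :=
  ∑ i : Fin n, ((t i.succ : ℝ) - t i.castSucc) / 2 * (W (t i.castSucc) ω + W (t i.succ) ω)

omit [IsProbabilityMeasure P] in
theorem memLp_trapezoidalSum (hW : IsBrownianReal W P) {n : ℕ} (t : Fin (n + 1) → ℝ≥0) :
    MemLp (trapezoidalSum t W) 2 P :=
  memLp_finsetSum _ fun _ _ => ((memLp_eval hW _).add (memLp_eval hW _)).const_mul _

omit [IsProbabilityMeasure P] in
theorem integral_trapezoidalSum_mul (hW : IsBrownianReal W P) {n : ℕ} (t : Fin (n + 1) → ℝ≥0)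
    {Z : Ω → ℝ} (hZ : MemLp Z 2 P) :
    ∫ ω, trapezoidalSum t W ω * Z ω ∂P = ∑ i : Fin n, ((t i.succ : ℝ) - t i.castSucc) / 2 *
      ((∫ ω, W (t i.castSucc) ω * Z ω ∂P) + ∫ ω, W (t i.succ) ω * Z ω ∂P) := by
  have hi : ∀ r, Integrable (fun ω => W r ω * Z ω) P := fun r => (memLp_eval hW r).integrable_mul hZ
  simp_rw [← fun i : Fin n => integral_add (hi (t i.castSucc)) (hi (t i.succ)),
    ← integral_const_mul]
  have hadd (i : Fin n) : Integrable (fun ω => ((t i.succ : ℝ) - t i.castSucc) / 2 *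
      (W (t i.castSucc) ω * Z ω + W (t i.succ) ω * Z ω)) P := ((hi _).add (hi _)).const_mul _
  rw [← integral_finsetSum _ fun i _ => hadd i]
  congr 1 with ω
  rw [trapezoidalSum, Finset.sum_mul]
  exact Finset.sum_congr rfl fun i _ => by ring

/-- The path integral minus its trapezoidal sum is orthogonal to every square integrable
function of the values of `W` at the nodes. -/
theorem integral_pathIntegral_mul_eq (hW : IsBrownianReal W P) {T : ℝ≥0} {n : ℕ}
    {t : Fin (n + 1) → ℝ≥0} (ht : StrictMono t) (h0 : t 0 = 0) (hT : t (Fin.last n) = T)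
    {g : (Fin (n + 1) → ℝ) → ℝ} (hg : Measurable g)
    (hZ : MemLp (fun ω => g fun j => W (t j) ω) 2 P) :
    ∫ ω, pathIntegral T W ω * g (fun j => W (t j) ω) ∂P =
      ∫ ω, trapezoidalSum t W ω * g (fun j => W (t j) ω) ∂P := by
  rw [integral_pathIntegral_mul hW T hZ, integral_trapezoidalSum_mul hW t hZ]
  set f : ℝ → ℝ := fun s => ∫ ω, W s.toNNReal ω * g (fun j => W (t j) ω) ∂P with hf
  have haff (i : Fin n) := integral_of_affine (f := f) (a := t i.castSucc) (b := t i.succ)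
    (by exact_mod_cast ht i.castSucc_lt_succ) (by
      intro s hs
      have hs0 : 0 ≤ s := (NNReal.coe_nonneg _).trans hs.1
      lift s to ℝ≥0 using hs0
      simp only [hf, Real.toNNReal_coe]
      refine integral_eval_mul_of_mem_Icc hW (by exact_mod_cast hs.1) (by exact_mod_cast hs.2)
        (ht i.castSucc_lt_succ) (fun j => ?_) hg hZ
      rcases le_or_gt j i.castSucc with h | h
      · exact Or.inl (ht.monotone h)
      · exact Or.inr (ht.monotone (Fin.castSucc_lt_iff_succ_le.1 h)))
  have hsum := (integral_eq_sum_fin (fun i => (t i : ℝ)) fun i => (haff i).1).2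
  simp only [h0, hT, NNReal.coe_zero] at hsum
  rw [hsum]
  refine Finset.sum_congr rfl fun i _ => ?_
  rw [(haff i).2]
  simp [hf]

/-- By Fubini this is the integral of the covariance `min s r`, split at its kink `s = r`. -/
theorem integral_pathIntegral_mul_eval (hW : IsBrownianReal W P) {T r : ℝ≥0} (hr : r ≤ T) :
    ∫ ω, pathIntegral T W ω * W r ω ∂P = (r : ℝ) * T - (r : ℝ) ^ 2 / 2 := by
  rw [integral_pathIntegral_mul hW T (memLp_eval hW r)]
  simp_rw [integral_eval_mul_eval hW]
  have hc : Continuous fun s : ℝ => ((min s.toNNReal r : ℝ≥0) : ℝ) := by fun_prop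
  rw [← intervalIntegral.integral_add_adjacent_intervals (b := (r : ℝ))
    (hc.intervalIntegrable _ _) (hc.intervalIntegrable _ _)]
  have h1 : ∫ s in (0 : ℝ)..r, ((min s.toNNReal r : ℝ≥0) : ℝ) = ∫ s in (0 : ℝ)..r, s := by
    refine intervalIntegral.integral_congr fun s hs => ?_
    rw [Set.uIcc_of_le r.coe_nonneg] at hs
    simp [hs.1, hs.2]
  have h2 : ∫ s in (r : ℝ)..T, ((min s.toNNReal r : ℝ≥0) : ℝ) = ∫ s in (r : ℝ)..T, (r : ℝ) := by
    refine intervalIntegral.integral_congr fun s hs => ?_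
    rw [Set.uIcc_of_le (by exact_mod_cast hr)] at hs
    simp [hs.1]
  rw [h1, h2, integral_id, intervalIntegral.integral_const, smul_eq_mul]
  ring

theorem measurable_trapezoid {n : ℕ} (t : Fin (n + 1) → ℝ≥0) :
    Measurable fun x : Fin (n + 1) → ℝ =>
      ∑ i : Fin n, ((t i.succ : ℝ) - t i.castSucc) / 2 * (x i.castSucc + x i.succ) := by
  fun_prop

/-- The mean square error of the trapezoidal sum. -/
theorem integral_sq_pathIntegral_sub_trapezoidalSum (hW : IsBrownianReal W P) {T : ℝ≥0} {n : ℕ}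
    {t : Fin (n + 1) → ℝ≥0} (ht : StrictMono t) (h0 : t 0 = 0) (hT : t (Fin.last n) = T) :
    ∫ ω, (pathIntegral T W ω - trapezoidalSum t W ω) ^ 2 ∂P =
      ∑ i : Fin n, ((t i.succ : ℝ) - t i.castSucc) ^ 3 / 12 := by
  have hI := memLp_pathIntegral hW T
  have hQ := memLp_trapezoidalSum hW t
  have hIQ := integral_pathIntegral_mul_eq hW ht h0 hT (measurable_trapezoid t) hQ
  change ∫ ω, pathIntegral T W ω * trapezoidalSum t W ω ∂P =
    ∫ ω, trapezoidalSum t W ω * trapezoidalSum t W ω ∂P at hIQ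
  -- As `I - Q` is orthogonal to `Q`, only `E[(I - Q) I]` remains.
  have hexp : ∫ ω, (pathIntegral T W ω - trapezoidalSum t W ω) ^ 2 ∂P =
      (∫ ω, pathIntegral T W ω * pathIntegral T W ω ∂P)
        - ∫ ω, trapezoidalSum t W ω * pathIntegral T W ω ∂P := by
    have h1 : ∀ ω, (pathIntegral T W ω - trapezoidalSum t W ω) ^ 2 =
        (pathIntegral T W ω * pathIntegral T W ω - trapezoidalSum t W ω * pathIntegral T W ω) -
        (pathIntegral T W ω * trapezoidalSum t W ω
          - trapezoidalSum t W ω * trapezoidalSum t W ω) := fun ω => by ring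
    simp_rw [h1]
    have a1 : Integrable (fun ω => pathIntegral T W ω * pathIntegral T W ω) P := hI.integrable_mul hI
    have a2 : Integrable (fun ω => trapezoidalSum t W ω * pathIntegral T W ω) P :=
      hQ.integrable_mul hI
    have a3 : Integrable (fun ω => pathIntegral T W ω * trapezoidalSum t W ω) P :=
      hI.integrable_mul hQ
    have a4 : Integrable (fun ω => trapezoidalSum t W ω * trapezoidalSum t W ω) P :=
      hQ.integrable_mul hQ
    have a12 := integral_sub a1 a2
    have a34 := integral_sub a3 a4
    refine (integral_sub (a1.sub a2) (a3.sub a4)).trans ?_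
    simp only [Pi.sub_apply]
    rw [a12, a34, hIQ]
    ring
  have hle : ∀ i, t i ≤ T := fun i => hT ▸ ht.monotone (Fin.le_last i)
  have hcov : ∀ r ≤ T, ∫ ω, W r ω * pathIntegral T W ω ∂P = (r : ℝ) * T - (r : ℝ) ^ 2 / 2 := by
    intro r hr
    rw [← integral_pathIntegral_mul_eval hW hr]
    simp_rw [mul_comm]
  have hII : ∫ ω, pathIntegral T W ω * pathIntegral T W ω ∂P =
      ∫ s in (0 : ℝ)..T, (s * T - s ^ 2 / 2) := by
    rw [integral_pathIntegral_mul hW T hI]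
    refine intervalIntegral.integral_congr fun s hs => ?_
    rw [Set.uIcc_of_le T.coe_nonneg] at hs
    rw [hcov _ (Real.toNNReal_le_iff_le_coe.2 hs.2), Real.coe_toNNReal _ hs.1]
  have hc : Continuous fun s : ℝ => s * T - s ^ 2 / 2 := by fun_prop
  have hsum := (integral_eq_sum_fin (fun i => (t i : ℝ)) fun i => hc.intervalIntegrable _ _).2
  simp only [h0, hT, NNReal.coe_zero] at hsum
  -- What is left is the deterministic trapezoidal error for `k s = s * T - s ^ 2 / 2`; since `k'' =
  -- -1`, each step of length `h` contributes `h ^ 3 / 12`.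
  rw [hexp, hII, hsum, integral_trapezoidalSum_mul hW t hI, ← Finset.sum_sub_distrib]
  refine Finset.sum_congr rfl fun i _ => ?_
  rw [hcov _ (hle _), hcov _ (hle _), intervalIntegral.integral_sub
    (Continuous.intervalIntegrable (by fun_prop) _ _)
    (Continuous.intervalIntegrable (by fun_prop) _ _),
    intervalIntegral.integral_mul_const, intervalIntegral.integral_div, integral_id, integral_pow]
  push_cast
  ring

omit [IsProbabilityMeasure P] in
theorem eLpNorm_two_eq_sqrt {f : Ω → ℝ} (hf : MemLp f 2 P) :
    eLpNorm f 2 P = ENNReal.ofReal √(∫ ω, f ω ^ 2 ∂P) := by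
  rw [hf.eLpNorm_eq_integral_rpow_norm (by norm_num) (by norm_num), Real.sqrt_eq_rpow]
  norm_num

/-- No function of the values of `W` at the nodes has a smaller error than the trapezoidal sum. -/
theorem l2Error_trapezoidalSum_le (hW : IsBrownianReal W P) {T : ℝ≥0} {n : ℕ}
    {t : Fin (n + 1) → ℝ≥0} (ht : StrictMono t) (h0 : t 0 = 0) (hT : t (Fin.last n) = T)
    {φ : (Fin (n + 1) → ℝ) → ℝ} (hφ : Measurable φ) :
    l2Error P T W (trapezoidalSum t W) ≤ l2Error P T W fun ω => φ fun j => W (t j) ω := by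
  have hI := memLp_pathIntegral hW T
  have hQ := memLp_trapezoidalSum hW t
  have hY : AEStronglyMeasurable (fun ω => φ fun j => W (t j) ω) P :=
    (hφ.comp_aemeasurable (aemeasurable_pi_lambda _ fun j =>
      hW.toIsPreBrownianReal.aemeasurable (t j))).aestronglyMeasurable
  by_cases hD : MemLp (fun ω => pathIntegral T W ω - φ fun j => W (t j) ω) 2 P
  swap
  · have : l2Error P T W (fun ω => φ fun j => W (t j) ω) = ⊤ := by
      by_contra h
      exact hD ⟨hI.1.sub hY, lt_top_iff_ne_top.2 h⟩
    rw [this]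
    exact le_top
  have hE : MemLp (fun ω => pathIntegral T W ω - trapezoidalSum t W ω) 2 P := hI.sub hQ
  -- Square integrability comes from `Q - φ = (I - φ) - (I - Q)`, with no moment assumption on `φ`.
  have hZ : MemLp (fun ω => trapezoidalSum t W ω - φ fun j => W (t j) ω) 2 P := by
    convert hD.sub hE using 1
    ext ω
    simp
  have horth := integral_pathIntegral_mul_eq hW ht h0 hT ((measurable_trapezoid t).sub hφ) hZ
  have hEZ : ∫ ω, (pathIntegral T W ω - trapezoidalSum t W ω) *
      (trapezoidalSum t W ω - φ fun j => W (t j) ω) ∂P = 0 := by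
    simp_rw [sub_mul _ _ (trapezoidalSum t W _ - _)]
    exact (integral_sub (hI.integrable_mul hZ) (hQ.integrable_mul hZ)).trans (sub_eq_zero.2 horth)
  unfold l2Error
  rw [eLpNorm_two_eq_sqrt hE, eLpNorm_two_eq_sqrt hD]
  refine ENNReal.ofReal_le_ofReal (Real.sqrt_le_sqrt ?_)
  have hexp : ∫ ω, (pathIntegral T W ω - φ fun j => W (t j) ω) ^ 2 ∂P =
      ∫ ω, (pathIntegral T W ω - trapezoidalSum t W ω) ^ 2 ∂P
      + 2 * (∫ ω, (pathIntegral T W ω - trapezoidalSum t W ω) *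
          (trapezoidalSum t W ω - φ fun j => W (t j) ω) ∂P)
      + ∫ ω, (trapezoidalSum t W ω - φ fun j => W (t j) ω) ^ 2 ∂P := by
    have hi : Integrable (fun ω => 2 * ((pathIntegral T W ω - trapezoidalSum t W ω) *
        (trapezoidalSum t W ω - φ fun j => W (t j) ω))) P := (hE.integrable_mul hZ).const_mul 2
    rw [← integral_const_mul, ← integral_add hE.integrable_sq hi,
      ← integral_add (hE.integrable_sq.fun_add hi) hZ.integrable_sq]
    congr 1 with ω
    ring
  rw [hexp, hEZ]
  have : 0 ≤ ∫ ω, (trapezoidalSum t W ω - φ fun j => W (t j) ω) ^ 2 ∂P :=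
    integral_nonneg fun ω => sq_nonneg _
  linarith

theorem l2Error_trapezoidalSum (hW : IsBrownianReal W P) {T : ℝ≥0} {n : ℕ}
    {t : Fin (n + 1) → ℝ≥0} (ht : StrictMono t) (h0 : t 0 = 0) (hT : t (Fin.last n) = T) :
    l2Error P T W (trapezoidalSum t W) =
      ENNReal.ofReal √(∑ i : Fin n, ((t i.succ : ℝ) - t i.castSucc) ^ 3 / 12) := by
  rw [← integral_sq_pathIntegral_sub_trapezoidalSum hW ht h0 hT]
  exact eLpNorm_two_eq_sqrt ((memLp_pathIntegral hW T).sub (memLp_trapezoidalSum hW t))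

end WienerIntegration

/-! ### Equidistant nodes and optimality -/

namespace WienerIntegration

/-- The equidistant nodes `i T / n`. -/
noncomputable def eqKnots (T : ℝ≥0) (n : ℕ) (i : Fin (n + 1)) : ℝ≥0 := (i : ℕ) * T / n

theorem eqKnots_strictMono {T : ℝ≥0} (hT : 0 < T) {n : ℕ} (hn : 0 < n) :
    StrictMono (eqKnots T n) := by
  intro i j hij
  have h : ((i : ℕ) : ℝ≥0) < (j : ℕ) := by exact_mod_cast hij
  have hn' : (0 : ℝ≥0) < n := by exact_mod_cast hn
  unfold eqKnots
  gcongr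

theorem eqKnots_zero (T : ℝ≥0) (n : ℕ) : eqKnots T n 0 = 0 := by simp [eqKnots]

theorem eqKnots_last (T : ℝ≥0) {n : ℕ} (hn : 0 < n) : eqKnots T n (Fin.last n) = T := by
  have hn' : (n : ℝ≥0) ≠ 0 := by exact_mod_cast hn.ne'
  simp [eqKnots, hn']

theorem eqKnots_succ_sub (T : ℝ≥0) {n : ℕ} (i : Fin n) :
    (eqKnots T n i.succ : ℝ) - eqKnots T n i.castSucc = T / n := by
  simp only [eqKnots, Fin.val_succ, Fin.val_castSucc]
  push_cast
  ring

theorem trapezoidalRule_eq_trapezoidalSum {Ω : Type*} (T : ℝ≥0) (W : ℝ≥0 → Ω → ℝ) (n : ℕ+) :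
    trapezoidalRule T W n = trapezoidalSum (eqKnots T n) W := by
  ext ω
  rw [trapezoidalRule, trapezoidalSum, Finset.sum_range, Finset.mul_sum]
  refine Finset.sum_congr rfl fun i _ => ?_
  rw [eqKnots_succ_sub]
  simp only [eqKnots, Fin.val_succ, Fin.val_castSucc]
  push_cast
  ring

theorem trapezoidalRule_eq_of_zero {Ω : Type*} {T : ℝ≥0} {W : ℝ≥0 → Ω → ℝ} (n : ℕ+) {ω : Ω}
    (h : W 0 ω = 0) :
    trapezoidalRule T W n ω =
      (T : ℝ) / (n : ℕ) * ∑ i ∈ Finset.range (n : ℕ), W ((i : ℝ≥0) * T / (n : ℕ)) ω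
        + (T : ℝ) / (2 * (n : ℕ)) * W T ω := by
  have hn : ((n : ℕ) : ℝ≥0) ≠ 0 := by exact_mod_cast n.ne_zero
  have h1 := Finset.sum_range_succ (fun i : ℕ => W ((i : ℝ≥0) * T / (n : ℕ)) ω) n
  rw [Finset.sum_range_succ'] at h1
  simp only [Nat.cast_add, Nat.cast_one, Nat.cast_zero, zero_mul, zero_div, h, add_zero,
    mul_div_cancel_left₀ T hn] at h1
  rw [trapezoidalRule, Finset.sum_add_distrib, h1]
  ring

/-- The method behind the equidistant trapezoidal rule. -/
noncomputable def trapezoidalMethod {T : ℝ≥0} (hT : 0 < T) : SamplingMethod T where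
  knots n := eqKnots T n
  knots_strictMono n := eqKnots_strictMono hT n.pos
  knots_first n := eqKnots_zero T n
  knots_last n := eqKnots_last T n.pos
  -- A method does not observe `W 0`; its almost sure value `0` is put in front of the data.
  φ n x := (T : ℝ) / (2 * (n : ℕ)) * ∑ i : Fin n,
    ((Fin.cons 0 x : Fin ((n : ℕ) + 1) → ℝ) i.castSucc + x i)
  measurable_φ n := by
    have h (j : Fin ((n : ℕ) + 1)) :
        Measurable fun x : Fin (n : ℕ) → ℝ => (Fin.cons 0 x : Fin ((n : ℕ) + 1) → ℝ) j := by
      refine Fin.cases ?_ (fun k => ?_) j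
      · simp
      · simpa using measurable_pi_apply k
    exact (Finset.measurable_fun_sum _ fun i _ =>
      (h i.castSucc).add (measurable_pi_apply i)).const_mul _

theorem approx_trapezoidalMethod {Ω : Type*} {T : ℝ≥0} (hT : 0 < T) {W : ℝ≥0 → Ω → ℝ} (n : ℕ+)
    {ω : Ω} (h : W 0 ω = 0) :
    (trapezoidalMethod hT).approx W n ω = trapezoidalRule T W n ω := by
  have hinfo : (Fin.cons 0 ((trapezoidalMethod hT).info W n ω) : Fin ((n : ℕ) + 1) → ℝ) =
      fun j => W (eqKnots T n j) ω := by
    ext j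
    refine Fin.cases ?_ (fun k => ?_) j
    · simp [eqKnots_zero, h]
    · simp [SamplingMethod.info, trapezoidalMethod]
  change (T : ℝ) / (2 * (n : ℕ)) * ∑ i : Fin n, ((Fin.cons 0 ((trapezoidalMethod hT).info W n ω) :
    Fin ((n : ℕ) + 1) → ℝ) i.castSucc + W (eqKnots T n i.succ) ω) = _
  rw [hinfo, trapezoidalRule, Finset.sum_range]
  simp [eqKnots]

theorem rpow_div_sqrt_eq_sqrt (T : ℝ≥0) {n : ℕ} (hn : 0 < n) :
    (T : ℝ) ^ (3 / 2 : ℝ) / √12 * (n : ℝ)⁻¹ = √((T : ℝ) ^ 3 / n ^ 2 / 12) := by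
  have h : (T : ℝ) ^ (3 / 2 : ℝ) = √((T : ℝ) ^ 3) := by
    rw [Real.sqrt_eq_rpow, ← Real.rpow_natCast_mul T.coe_nonneg]
    norm_num
  rw [h, Real.sqrt_div' _ (by norm_num), Real.sqrt_div' _ (by positivity),
    Real.sqrt_sq (by positivity)]
  ring

/-- The power mean inequality for cubes, applied to the step lengths, whose sum telescopes to `T`.
-/
theorem cube_div_sq_le_sum {T : ℝ≥0} {n : ℕ} {t : Fin (n + 1) → ℝ≥0} (ht : StrictMono t)
    (h0 : t 0 = 0) (hT : t (Fin.last n) = T) :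
    (T : ℝ) ^ 3 / n ^ 2 / 12 ≤ ∑ i : Fin n, ((t i.succ : ℝ) - t i.castSucc) ^ 3 / 12 := by
  have hsum : ∑ i : Fin n, ((t i.succ : ℝ) - t i.castSucc) = T := by
    -- The telescoping is read off from integrating the constant `1`.
    have h := (integral_eq_sum_fin (f := fun _ => 1) (fun i => (t i : ℝ)) fun _ =>
      intervalIntegrable_const).2
    simpa [h0, hT] using h.symm
  have h := pow_sum_div_card_le_sum_pow (s := Finset.univ)
    (f := fun i : Fin n => (t i.succ : ℝ) - t i.castSucc)
    (fun i _ => sub_nonneg.2 (by exact_mod_cast (ht i.castSucc_lt_succ).le)) 2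
  rw [hsum, Finset.card_univ, Fintype.card_fin] at h
  rw [← Finset.sum_div]
  gcongr

theorem l2Error_congr {Ω : Type*} [MeasurableSpace Ω] {P : Measure Ω} {T : ℝ≥0}
    {W : ℝ≥0 → Ω → ℝ} {Y Z : Ω → ℝ} (h : Y =ᵐ[P] Z) : l2Error P T W Y = l2Error P T W Z :=
  eLpNorm_congr_ae (by filter_upwards [h] with ω hω; rw [hω])

variable {Ω : Type*} [MeasurableSpace Ω] {P : Measure Ω} [IsProbabilityMeasure P]
  {W : ℝ≥0 → Ω → ℝ}

theorem l2Error_trapezoidalRule (hW : IsBrownianReal W P) {T : ℝ≥0} (hT : 0 < T) (n : ℕ+) :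
    l2Error P T W (trapezoidalRule T W n) =
      ENNReal.ofReal ((T : ℝ) ^ (3 / 2 : ℝ) / √12 * ((n : ℕ) : ℝ)⁻¹) := by
  have hn : ((n : ℕ) : ℝ) ≠ 0 := by exact_mod_cast n.ne_zero
  rw [trapezoidalRule_eq_trapezoidalSum, l2Error_trapezoidalSum hW
    (eqKnots_strictMono hT n.pos) (eqKnots_zero T n) (eqKnots_last T n.pos),
    rpow_div_sqrt_eq_sqrt T n.pos]
  simp_rw [eqKnots_succ_sub]
  rw [Finset.sum_const, Finset.card_univ, Fintype.card_fin, nsmul_eq_mul]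
  congr 2
  field_simp

theorem le_l2Error_approx (hW : IsBrownianReal W P) {T : ℝ≥0} (X : SamplingMethod T) (n : ℕ+) :
    ENNReal.ofReal ((T : ℝ) ^ (3 / 2 : ℝ) / √12 * ((n : ℕ) : ℝ)⁻¹) ≤
      l2Error P T W (X.approx W n) := by
  -- `X.φ n` is viewed as a function of all `n + 1` node values that ignores the one at time `0`.
  have hφ : Measurable fun x : Fin ((n : ℕ) + 1) → ℝ => X.φ n fun i => x i.succ :=
    (X.measurable_φ n).comp (measurable_pi_lambda _ fun i => measurable_pi_apply i.succ)
  have hle := l2Error_trapezoidalSum_le hW (X.knots_strictMono n) (X.knots_first n)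
    (X.knots_last n) hφ
  rw [l2Error_trapezoidalSum hW (X.knots_strictMono n) (X.knots_first n) (X.knots_last n)] at hle
  refine le_trans ?_ hle
  rw [rpow_div_sqrt_eq_sqrt T n.pos]
  exact ENNReal.ofReal_le_ofReal (Real.sqrt_le_sqrt
    (cube_div_sq_le_sum (X.knots_strictMono n) (X.knots_first n) (X.knots_last n)))

omit [IsProbabilityMeasure P] in
theorem approx_trapezoidalMethod_ae_eq (hW : IsBrownianReal W P) {T : ℝ≥0} (hT : 0 < T) (n : ℕ+) :
    (trapezoidalMethod hT).approx W n =ᵐ[P] trapezoidalRule T W n := by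
  filter_upwards [hW.toIsPreBrownianReal.eval_zero_ae_eq_zero] with ω hω
    using approx_trapezoidalMethod hT n hω

omit [IsProbabilityMeasure P] in
theorem trapezoidalMethod_mem_eqClass (hW : IsBrownianReal W P) {T : ℝ≥0} (hT : 0 < T) :
    trapezoidalMethod hT ∈ eqClass P T W := by
  refine ⟨fun n => ?_, fun n i => rfl⟩
  rw [memLp_congr_ae (approx_trapezoidalMethod_ae_eq hW hT n), trapezoidalRule_eq_trapezoidalSum]
  exact memLp_trapezoidalSum hW _

end WienerIntegration

theorem mainTheorem9 {Ω : Type*} [MeasurableSpace Ω] (P : Measure Ω) [IsProbabilityMeasure P]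
    (W : ℝ≥0 → Ω → ℝ) (hW : IsBrownianReal W P) (T : ℝ≥0) (hT : 0 < T) :
    -- the trapezoidal rule is, almost surely, a method with equidistant partitions
    (∃ X ∈ WienerIntegration.eqClass P T W, ∀ n : ℕ+,
      X.approx W n =ᵐ[P] WienerIntegration.trapezoidalRule T W n) ∧
    ∀ n : ℕ+,
      -- the second form of the trapezoidal rule
      (∀ᵐ ω ∂P, WienerIntegration.trapezoidalRule T W n ω =
        (T : ℝ) / (n : ℕ) * ∑ i ∈ Finset.range (n : ℕ), W ((i : ℝ≥0) * T / (n : ℕ)) ω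
          + (T : ℝ) / (2 * (n : ℕ)) * W T ω) ∧
      -- lower bound for every method
      (∀ X : WienerIntegration.SamplingMethod T,
        ENNReal.ofReal ((T : ℝ) ^ (3 / 2 : ℝ) / √12 * ((n : ℕ) : ℝ)⁻¹) ≤
          WienerIntegration.l2Error P T W (X.approx W n)) ∧
      -- exact error of the trapezoidal rule
      WienerIntegration.l2Error P T W (WienerIntegration.trapezoidalRule T W n) =
        ENNReal.ofReal ((T : ℝ) ^ (3 / 2 : ℝ) / √12 * ((n : ℕ) : ℝ)⁻¹) ∧
      -- optimality
      WienerIntegration.l2Error P T W (WienerIntegration.trapezoidalRule T W n) =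
        ⨅ X ∈ WienerIntegration.noneqClass P T W,
          WienerIntegration.l2Error P T W (X.approx W n) := by
  have hmem := WienerIntegration.trapezoidalMethod_mem_eqClass hW hT
  have happrox := WienerIntegration.approx_trapezoidalMethod_ae_eq hW hT
  refine ⟨⟨WienerIntegration.trapezoidalMethod hT, hmem, happrox⟩, fun n => ?_⟩
  have herr := WienerIntegration.l2Error_trapezoidalRule hW hT n
  have hlower := fun X : WienerIntegration.SamplingMethod T =>
    WienerIntegration.le_l2Error_approx hW X n
  refine ⟨?_, hlower, herr, ?_⟩
  · filter_upwards [hW.toIsPreBrownianReal.eval_zero_ae_eq_zero] with ω hω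
      using WienerIntegration.trapezoidalRule_eq_of_zero n hω
  · refine le_antisymm (le_iInf₂ fun X _ => herr.trans_le (hlower X)) ?_
    -- The infimum is attained at the equidistant method, which agrees almost surely with the rule.
    exact (iInf₂_le _ hmem.1).trans_eq (WienerIntegration.l2Error_congr (happrox n))
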